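/- Let $H^2$ be the hyperbolic plane (upper half-plane model) with its hyperbolic distance $d_H(z,w)=2\tanh^{-1}\frac{|z-w|}{|z-\overline{w}|}$, and let the bidisk $H^2\times H^2$ carry the product distance $\rho(\mathsf z,\mathsf w)=\sqrt{d_H(z_1,w_1)^2+d_H(z_2,w_2)^2}$. For a metric space $X$ let $\mathrm{Isom}(X)$ denote the group of isometries of $X$ onto itself. The group $\mathrm{Isom}(H^2)\times \mathrm{Isom}(H^2)$ acts on $H^2\times H^2$ by isometries via $(g_1,g_2)(z_1,z_2)=(g_1(z_1),g_2(z_2))$; let $\Gamma\le\mathrm{Isom}(H^2\times H^2)$ be the group of isometries arising in this way, and let $\iota(z_1,z_2)=(z_2,z_1)$ be the coordinate swap. **Theorem.** Every isometry of $H^2\times H^2$ is either a product $(g_1,g_2)$ with $g_1,g_2\in\mathrm{Isom}(H^2)$, or such a product composed with $\iota$. Moreover $$\mathrm{Isom}(H^2\times H^2)=\Gamma\rtimes\langle\iota\rangle .$$ That is: the action of $\mathrm{Isom}(H^2)\times\mathrm{Isom}(H^2)$ is faithful (so that $\Gamma\cong\mathrm{Isom}(H^2)\times\mathrm{Isom}(H^2)$),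 $\iota$ has order $2$, $\Gamma$ is normal in $\mathrm{Isom}(H^2\times H^2)$, $\Gamma\cap\langle\iota\rangle=\{1\}$, and $\Gamma$ and $\langle\iota\rangle$ together generate $\mathrm{Isom}(H^2\times H^2)$. Equivalently, the product action and the inclusion of $\langle\iota\rangle$ induce a group isomorphism $$(\mathrm{Isom}(H^2)\times\mathrm{Isom}(H^2))\rtimes\langle\iota\rangle\;\cong\;\mathrm{Isom}(H^2\times H^2),$$ where $\iota$ acts on $\mathrm{Isom}(H^2)\times\mathrm{Isom}(H^2)$ by $(g_1,g_2)\mapsto(g_2,g_1)$. -/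

import Mathlib

open scoped UpperHalfPlane

noncomputable section

/-- The group `Isom(X)` of isometries of a metric space `X` onto itself, under composition. -/
abbrev Isom (X : Type*) [MetricSpace X] : Type _ := X ≃ᵢ X

/-- The bidisk `H² × H²`: two copies of the upper half-plane, each with its hyperbolic distance,
carrying the `ℓ²` product distance (not the sup distance of `ℍ × ℍ`). -/
abbrev Bidisk : Type := WithLp 2 (ℍ × ℍ)

/-- The distance of the bidisk is `ρ(z, w) = √(d_H(z₁, w₁)² + d_H(z₂, w₂)²)`. -/
theorem Bidisk.dist_eq (z w : Bidisk) :
    dist z w = Real.sqrt (dist z.fst w.fst ^ 2 + dist z.snd w.snd ^ 2) := by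
  rw [WithLp.prod_dist_eq_add (by norm_num), Real.sqrt_eq_rpow]
  simp

/-- The product action `(g₁, g₂)(z₁, z₂) = (g₁ z₁, g₂ z₂)` of `Isom(H²) × Isom(H²)` on the bidisk,
as a homomorphism to the isometry group of the bidisk. -/
def Bidisk.prodHom : Isom ℍ × Isom ℍ →* Isom Bidisk where
  toFun g := IsometryEquiv.withLpProdCongr 2 g.1 g.2
  map_one' := rfl
  map_mul' _ _ := rfl

theorem Bidisk.prodHom_apply (g : Isom ℍ × Isom ℍ) (z : Bidisk) :
    Bidisk.prodHom g z = WithLp.toLp 2 (g.1 z.fst, g.2 z.snd) := rfl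

/-- The coordinate swap `ι(z₁, z₂) = (z₂, z₁)`. -/
def Bidisk.swap : Isom Bidisk := IsometryEquiv.withLpProdComm 2 ℍ ℍ

theorem Bidisk.swap_apply (z : Bidisk) :
    Bidisk.swap z = WithLp.toLp 2 (z.snd, z.fst) := rfl

/-- The group `Γ` of products of isometries of `H²`, as a subgroup of `Isom(H² × H²)`. -/
def Bidisk.Gam : Subgroup (Isom Bidisk) := Bidisk.prodHom.range

end

/-! The point is to recover from the distance alone when two points of the bidisk share a
coordinate. In H², a median is no longer than the Euclidean median of a triangle with the same
sides, with equality exactly for collinear vertices (`exists_midpoint`). Squared distances add over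
the factors, so the defects add too. Vanishing of the total defect is metric and means collinearity
in each factor: isometries preserve `Aligned` (`aligned_map_iff`).

If p and q differ in both coordinates, all points aligned with them lie on one product of two lines;
if they share a coordinate, that coordinate is unconstrained. Hence isometries preserve sharing a
coordinate (`map_fst_eq_or_snd_eq_iff`), and a combinatorial argument on the rook's graph
(`exists_prodMap_or_swap`) makes them product maps up to the swap. The rest is group theory. -/

noncomputable section

/-! ### Strict concavity of log cosh √u. -/

namespace Real

theorem self_lt_sinh_mul_cosh {x : ℝ} (hx : 0 < x) : x < sinh x * cosh x := by
  have h1 : x < sinh x := self_lt_sinh_iff.2 hx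
  have h2 : 1 ≤ cosh x := one_le_cosh x
  nlinarith

/-- Since cosh² - sinh² = 1, the numerator of the derivative is x - sinh x cosh x. At x = √u the
function is twice the derivative of log cosh √u. -/
theorem strictAntiOn_sinh_div_mul_cosh :
    StrictAntiOn (fun x : ℝ => sinh x / (x * cosh x)) (Set.Ioi 0) := by
  have hd : ∀ x ∈ Set.Ioi (0 : ℝ), HasDerivAt (fun x : ℝ => sinh x / (x * cosh x))
      ((cosh x * (x * cosh x) - sinh x * (1 * cosh x + x * sinh x)) / (x * cosh x) ^ 2) x := by
    intro x hx
    have hx' : x ≠ 0 := ne_of_gt hx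
    exact (hasDerivAt_sinh x).div ((hasDerivAt_id x).mul (hasDerivAt_cosh x))
      (mul_ne_zero hx' (cosh_pos x).ne')
  refine strictAntiOn_of_deriv_neg (convex_Ioi 0)
    (fun x hx => (hd x hx).continuousAt.continuousWithinAt) ?_
  intro x hx
  rw [interior_Ioi] at hx
  have hx0 : (0 : ℝ) < x := hx
  rw [(hd x hx).deriv]
  apply div_neg_of_neg_of_pos
  · have := self_lt_sinh_mul_cosh hx0
    have h2 := cosh_sq x
    nlinarith
  · have := cosh_pos x
    positivity

/-- The function `u ↦ log (cosh √u)` is strictly concave on the half-line. -/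
theorem strictConcaveOn_log_cosh_sqrt :
    StrictConcaveOn ℝ (Set.Ici 0) (fun u : ℝ => log (cosh (sqrt u))) := by
  have hc : Continuous (fun u : ℝ => log (cosh (sqrt u))) :=
    (continuous_cosh.comp continuous_sqrt).log fun u => (cosh_pos _).ne'
  refine StrictAntiOn.strictConcaveOn_of_deriv (convex_Ici 0) hc.continuousOn ?_
  rw [interior_Ici]
  have hd : ∀ u ∈ Set.Ioi (0 : ℝ), deriv (fun u : ℝ => log (cosh (sqrt u))) u =
      sinh (sqrt u) / (sqrt u * cosh (sqrt u)) / 2 := by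
    intro u hu
    have hu' : u ≠ 0 := ne_of_gt hu
    have h := ((hasDerivAt_sqrt hu').cosh).log (cosh_pos _).ne'
    rw [h.deriv]
    have : sqrt u ≠ 0 := (sqrt_pos.2 hu).ne'
    have := (cosh_pos (sqrt u)).ne'
    field_simp
  intro u hu v hv huv
  rw [hd u hu, hd v hv]
  have := strictAntiOn_sinh_div_mul_cosh (Set.mem_Ioi.2 (sqrt_pos.2 hu))
    (Set.mem_Ioi.2 (sqrt_pos.2 hv)) (sqrt_lt_sqrt (le_of_lt hu) huv)
  simp only at this
  linarith

/-- With F(u) = log cosh √u, both c² and s² + t² - c² are convex combinations of s² and t², with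
exchanged weights. Adding the two concavity inequalities gives F(s²) + F(t²) < F(c²) + F(s² + t² -
c²), while the hypothesis says F(s²) + F(t²) = F(M²) + F(c²). -/
theorem sq_add_sq_lt_of_cosh_mul_cosh_eq {M c s t : ℝ} (ht : 0 ≤ t) (htc : t < c) (hcs : c < s)
    (h : cosh M * cosh c = cosh s * cosh t) : M ^ 2 + c ^ 2 < s ^ 2 + t ^ 2 := by
  have hst : 0 < s ^ 2 - t ^ 2 := by nlinarith
  set l : ℝ := (c ^ 2 - t ^ 2) / (s ^ 2 - t ^ 2) with hl
  have hl0 : 0 < l := div_pos (by nlinarith) hst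
  have hl1 : 0 < 1 - l := by
    rw [hl, sub_pos, div_lt_one hst]; nlinarith
  have hlc : l * (s ^ 2 - t ^ 2) = c ^ 2 - t ^ 2 := div_mul_cancel₀ _ hst.ne'
  have hne : s ^ 2 ≠ t ^ 2 := (sub_pos.1 hst).ne'
  have hF := strictConcaveOn_log_cosh_sqrt.2
  have h1 := hF (Set.mem_Ici.2 (sq_nonneg s)) (Set.mem_Ici.2 (sq_nonneg t)) hne hl0 hl1 (by ring)
  have h2 := hF (Set.mem_Ici.2 (sq_nonneg s)) (Set.mem_Ici.2 (sq_nonneg t)) hne hl1 hl0 (by ring)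
  have e1 : l • s ^ 2 + (1 - l) • t ^ 2 = c ^ 2 := by simp only [smul_eq_mul]; linarith
  have e2 : (1 - l) • s ^ 2 + l • t ^ 2 = s ^ 2 + t ^ 2 - c ^ 2 := by
    simp only [smul_eq_mul]; linarith
  simp only [e1, e2] at h1 h2
  simp only [smul_eq_mul, sqrt_sq_eq_abs, cosh_abs] at h1 h2
  have hlog : log (cosh M) + log (cosh c) = log (cosh s) + log (cosh t) := by
    rw [← log_mul (cosh_pos _).ne' (cosh_pos _).ne', h, log_mul (cosh_pos _).ne' (cosh_pos _).ne']
  have h3 : log (cosh M) < log (cosh (sqrt (s ^ 2 + t ^ 2 - c ^ 2))) := by linarith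
  rw [log_lt_log_iff (cosh_pos _) (cosh_pos _), cosh_lt_cosh, abs_of_nonneg (sqrt_nonneg _)] at h3
  have h4 := (lt_sqrt (abs_nonneg M)).1 h3
  rw [sq_abs] at h4
  linarith

end Real

/-! ### Collinearity and medians in the hyperbolic plane. -/

namespace UpperHalfPlane

/-- The determinant that vanishes exactly when three points lie on a common hyperbolic line. -/
def lineDet (r p q : ℍ) : ℝ :=
  (p.re * (q.re ^ 2 + q.im ^ 2) - q.re * (p.re ^ 2 + p.im ^ 2)) +
    r.re * ((p.re ^ 2 + p.im ^ 2) - (q.re ^ 2 + q.im ^ 2)) +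
    (r.re ^ 2 + r.im ^ 2) * (q.re - p.re)

/-- Both sides are the Gram determinant of the three points in the hyperboloid model. The left
factors vanish at the equality cases of the triangle inequalities. -/
theorem gram_eq_lineDet_sq (r p q : ℍ) :
    (Real.cosh (dist r p + dist r q) - Real.cosh (dist p q)) *
      (Real.cosh (dist p q) - Real.cosh (dist r p - dist r q)) =
      (lineDet r p q / (2 * r.im * p.im * q.im)) ^ 2 := by
  have key : (Real.cosh (dist r p + dist r q) - Real.cosh (dist p q)) *
      (Real.cosh (dist p q) - Real.cosh (dist r p - dist r q)) =
      1 + 2 * Real.cosh (dist r p) * Real.cosh (dist r q) * Real.cosh (dist p q)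
        - Real.cosh (dist r p) ^ 2 - Real.cosh (dist r q) ^ 2 - Real.cosh (dist p q) ^ 2 := by
    rw [Real.cosh_add, Real.cosh_sub]
    have h1 := Real.sinh_sq (dist r p)
    have h2 := Real.sinh_sq (dist r q)
    linear_combination (Real.sinh (dist r q)) ^ 2 * h1 +
      (Real.cosh (dist r p) ^ 2 - 1) * h2
  rw [key, cosh_dist', cosh_dist', cosh_dist', lineDet]
  have h1 := r.im_ne_zero
  have h2 := p.im_ne_zero
  have h3 := q.im_ne_zero
  field_simp
  ring

theorem exists_cosh_midpoint (p q : ℍ) : ∃ m : ℍ, ∀ r : ℍ,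
    Real.cosh (dist r m) * (2 * Real.cosh (dist p q / 2)) =
      Real.cosh (dist r p) + Real.cosh (dist r q) := by
  have hp := p.im_pos
  have hq := q.im_pos
  set k : ℝ := 2 * Real.cosh (dist p q / 2) with hk
  have hk0 : 0 < k := by have := Real.cosh_pos (dist p q / 2); positivity
  have hk2 : k ^ 2 * (p.im * q.im) = (p.re - q.re) ^ 2 + (p.im + q.im) ^ 2 := by
    have h1 : Real.cosh (dist p q) = 2 * Real.cosh (dist p q / 2) ^ 2 - 1 := by
      have := Real.cosh_two_mul (dist p q / 2)
      have h3 := Real.sinh_sq (dist p q / 2)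
      rw [show 2 * (dist p q / 2) = dist p q by ring] at this
      linarith
    have h2 : k ^ 2 = 2 * (Real.cosh (dist p q) + 1) := by rw [hk, h1]; ring
    rw [h2, cosh_dist']
    field_simp
    ring
  -- In the hyperboloid model the midpoint is (p + q) / k, where k is the Lorentz norm of p + q; X
  -- and Y are its half-plane coordinates.
  set X : ℝ := (p.re * q.im + q.re * p.im) / (p.im + q.im) with hX
  set Y : ℝ := k * (p.im * q.im) / (p.im + q.im) with hY
  have hY0 : 0 < Y := by positivity
  refine ⟨⟨⟨X, Y⟩, hY0⟩, fun r => ?_⟩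
  have hr := r.im_pos
  simp only [cosh_dist']
  change ((r.re - X) ^ 2 + r.im ^ 2 + Y ^ 2) / (2 * r.im * Y) * k = _
  have hXY : X ^ 2 + Y ^ 2 =
      ((p.re ^ 2 + p.im ^ 2) * q.im + (q.re ^ 2 + q.im ^ 2) * p.im) / (p.im + q.im) := by
    have : Y ^ 2 = ((p.re - q.re) ^ 2 + (p.im + q.im) ^ 2) * (p.im * q.im) / (p.im + q.im) ^ 2 := by
      rw [← hk2, hY, div_pow]; ring
    rw [this, hX]
    field_simp
    ring
  have hnum : (r.re - X) ^ 2 + r.im ^ 2 + Y ^ 2 =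
      r.re ^ 2 + r.im ^ 2 - 2 * r.re * X + (X ^ 2 + Y ^ 2) := by ring
  rw [hnum, hXY, hX, hY]
  field_simp
  ring

/-- The defect in the comparison of a hyperbolic median (from `r` to the point `m`) with the
Euclidean median of the triangle with the same sides. -/
def medianDefect (r p q m : ℍ) : ℝ :=
  (dist r p ^ 2 + dist r q ^ 2) / 2 - dist p q ^ 2 / 4 - dist r m ^ 2

theorem lineDet_eq_zero_iff (r p q : ℍ) :
    lineDet r p q = 0 ↔ dist r p + dist r q = dist p q ∨ dist p q = |dist r p - dist r q| := by
  have h := gram_eq_lineDet_sq r p q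
  have h0 : lineDet r p q = 0 ↔ (lineDet r p q / (2 * r.im * p.im * q.im)) ^ 2 = 0 := by
    have h1 := r.im_ne_zero
    have h2 := p.im_ne_zero
    have h3 := q.im_ne_zero
    simp [h1, h2, h3]
  have hc : ∀ {x y : ℝ}, 0 ≤ x → 0 ≤ y → (Real.cosh x - Real.cosh y = 0 ↔ x = y) := by
    intro x y hx hy
    rw [sub_eq_zero]
    exact Real.cosh_strictMonoOn.injOn.eq_iff hx hy
  rw [h0, ← h, mul_eq_zero, ← Real.cosh_abs (dist r p - dist r q),
    hc (by positivity) dist_nonneg, hc dist_nonneg (abs_nonneg _)]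

theorem exists_midpoint (p q : ℍ) : ∃ m : ℍ, dist p m = dist p q / 2 ∧ dist q m = dist p q / 2 ∧
    ∀ r : ℍ, 0 ≤ medianDefect r p q m ∧ (medianDefect r p q m = 0 ↔ lineDet r p q = 0) := by
  obtain ⟨m, hm⟩ := exists_cosh_midpoint p q
  have hcp := Real.cosh_pos (dist p q / 2)
  have hc2 : Real.cosh (dist p q) = 2 * Real.cosh (dist p q / 2) ^ 2 - 1 := by
    have := Real.cosh_two_mul (dist p q / 2)
    have h3 := Real.sinh_sq (dist p q / 2)
    rw [show 2 * (dist p q / 2) = dist p q by ring] at this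
    linarith
  have hinj : ∀ {x y : ℝ}, 0 ≤ x → 0 ≤ y → Real.cosh x = Real.cosh y → x = y :=
    fun hx hy h => Real.cosh_strictMonoOn.injOn hx hy h
  have hhalf : ∀ r : ℍ, Real.cosh (dist r p) + Real.cosh (dist r q) = 1 + Real.cosh (dist p q) →
      dist r m = dist p q / 2 := by
    intro r hr
    refine hinj dist_nonneg (by positivity) ?_
    have := hm r
    rw [hr, hc2] at this
    have h2 : 2 * Real.cosh (dist p q / 2) ≠ 0 := by positivity
    exact mul_right_cancel₀ h2 (by linarith)
  refine ⟨m, hhalf p (by simp), hhalf q (by simp [dist_comm q p, add_comm]), fun r => ?_⟩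
  -- In these variables the triangle inequalities read t ≤ c ≤ s, the median satisfies cosh(rm) cosh
  -- c = cosh s cosh t, and collinearity is equality at either end.
  set s := (dist r p + dist r q) / 2 with hs
  set t := |dist r p - dist r q| / 2 with ht
  set c := dist p q / 2 with hc
  have hcs : c ≤ s := by
    have := dist_triangle p r q
    rw [dist_comm p r] at this
    linarith
  have htc : t ≤ c := by
    have := abs_dist_sub_le p q r
    rw [dist_comm p r, dist_comm q r] at this
    linarith
  have ht0 : 0 ≤ t := by positivity
  have hM : Real.cosh (dist r m) * Real.cosh c = Real.cosh s * Real.cosh t := by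
    have h1 : Real.cosh (dist r p) + Real.cosh (dist r q) =
        2 * (Real.cosh s * Real.cosh ((dist r p - dist r q) / 2)) := by
      have e1 : dist r p = s + (dist r p - dist r q) / 2 := by rw [hs]; ring
      have e2 : dist r q = s - (dist r p - dist r q) / 2 := by rw [hs]; ring
      have a1 := congrArg Real.cosh e1
      have a2 := congrArg Real.cosh e2
      rw [Real.cosh_add] at a1
      rw [Real.cosh_sub] at a2
      linarith
    have h2 : Real.cosh t = Real.cosh ((dist r p - dist r q) / 2) := by
      rw [← Real.cosh_abs ((dist r p - dist r q) / 2), abs_div, abs_two]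
    have := hm r
    rw [h2]
    linarith
  have hD : medianDefect r p q m = s ^ 2 + t ^ 2 - c ^ 2 - dist r m ^ 2 := by
    have : t ^ 2 = (dist r p - dist r q) ^ 2 / 4 := by rw [ht, div_pow, sq_abs]; norm_num
    rw [medianDefect, this, hs, hc]
    ring
  have hdet : lineDet r p q = 0 ↔ s = c ∨ c = t := by
    rw [lineDet_eq_zero_iff]
    refine or_congr ?_ ?_ <;> constructor <;> intro h <;> linarith
  rw [hdet, hD]
  by_cases hsc : s = c
  · have : dist r m = t := by
      refine hinj dist_nonneg ht0 ?_
      rw [hsc, mul_comm] at hM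
      exact mul_left_cancel₀ hcp.ne' hM
    simp [hsc, this]
  by_cases hct : c = t
  · have : dist r m = s := by
      refine hinj dist_nonneg (by positivity) ?_
      rw [hct] at hM
      exact mul_right_cancel₀ (Real.cosh_pos t).ne' hM
    simp [hct, this]
  have hlt := Real.sq_add_sq_lt_of_cosh_mul_cosh_eq ht0 (lt_of_le_of_ne htc (Ne.symm hct))
    (lt_of_le_of_ne hcs (Ne.symm hsc)) hM
  simp only [hsc, hct, or_self, iff_false]
  exact ⟨by linarith, by linarith⟩

/-- The condition is linear in the vector (1, x, x² + y²) of the first point. Were the vectors of r,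
s, t independent, Cramer's rule would kill its coefficients, forcing p = q. -/
theorem lineDet_trans {p q r s t : ℍ} (hpq : p ≠ q) (hr : lineDet r p q = 0)
    (hs : lineDet s p q = 0) (ht : lineDet t p q = 0) : lineDet r s t = 0 := by
  by_contra hne
  refine hpq ?_
  unfold lineDet at *
  have h1 : q.re - p.re = 0 := by
    refine (mul_eq_zero.1 (?_ : _ * (q.re - p.re) = 0)).resolve_left hne
    linear_combination (s.re - t.re) * (-1) * hr + (t.re - r.re) * (-1) * hs +
      (r.re - s.re) * (-1) * ht
  have h2 : (p.re ^ 2 + p.im ^ 2) - (q.re ^ 2 + q.im ^ 2) = 0 := by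
    refine (mul_eq_zero.1 (?_ : _ * ((p.re ^ 2 + p.im ^ 2) - (q.re ^ 2 + q.im ^ 2)) = 0)).resolve_left
      hne
    linear_combination
      ((s.re ^ 2 + s.im ^ 2) - (t.re ^ 2 + t.im ^ 2)) * hr +
      ((t.re ^ 2 + t.im ^ 2) - (r.re ^ 2 + r.im ^ 2)) * hs +
      ((r.re ^ 2 + r.im ^ 2) - (s.re ^ 2 + s.im ^ 2)) * ht
  have hre : p.re = q.re := by linarith
  have him : p.im = q.im := by
    rw [hre] at h2
    have : p.im ^ 2 = q.im ^ 2 := by linarith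
    exact (pow_left_inj₀ p.im_pos.le q.im_pos.le two_ne_zero).1 this
  exact UpperHalfPlane.ext_re_im hre him

theorem exists_lineDet_ne_zero : ∃ r s t : ℍ, lineDet r s t ≠ 0 := by
  refine ⟨⟨⟨0, 1⟩, one_pos⟩, ⟨⟨0, 2⟩, two_pos⟩, ⟨⟨1, 1⟩, one_pos⟩, ?_⟩
  norm_num [lineDet, UpperHalfPlane.re, UpperHalfPlane.im]

theorem lineDet_self_left (p q : ℍ) : lineDet p p q = 0 := by
  unfold lineDet; ring

theorem lineDet_self_right (r p : ℍ) : lineDet r p p = 0 := by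
  unfold lineDet; ring

end UpperHalfPlane

/-! ### Automorphisms of the rook's graph. -/

/-- Two points of a product agree in at least one coordinate. -/
def AgreeSomewhere {A B : Type*} (p q : A × B) : Prop := p.1 = q.1 ∨ p.2 = q.2

section Rook

variable {A : Type*} {γ : A × A → A × A}

/-- A clique of the rook's graph lies in a single row or column. -/
theorem agreeSomewhere_fst_const_or_snd_const (hγ : Function.Injective γ)
    (h : ∀ p q, AgreeSomewhere p q → AgreeSomewhere (γ p) (γ q)) (x : A) :
    (∀ y y', (γ (x, y)).1 = (γ (x, y')).1) ∨ (∀ y y', (γ (x, y)).2 = (γ (x, y')).2) := by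
  have hag : ∀ y y', AgreeSomewhere (γ (x, y)) (γ (x, y')) := fun y y' => h _ _ (Or.inl rfl)
  have hinj : ∀ y y', (γ (x, y)).1 = (γ (x, y')).1 → (γ (x, y)).2 = (γ (x, y')).2 → y = y' :=
    fun y y' h1 h2 => (Prod.ext_iff.1 (hγ (Prod.ext h1 h2))).2
  by_contra! hcon
  obtain ⟨⟨a, b, hab⟩, c, d, hcd⟩ := hcon
  have h2 := (hag a b).resolve_left hab
  have h1 := (hag c d).resolve_right hcd
  have hac := hag a c
  have had := hag a d
  have hbc := hag b c
  have hbd := hag b d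
  unfold AgreeSomewhere at *
  grind

theorem fst_const_of_fst_const (hγ : Function.Injective γ)
    (h : ∀ p q, AgreeSomewhere (γ p) (γ q) ↔ AgreeSomewhere p q)
    {y₁ y₂ y₃ : A} (h₁₂ : y₁ ≠ y₂) (h₁₃ : y₁ ≠ y₃) (h₂₃ : y₂ ≠ y₃) {x₀ : A}
    (h₀ : ∀ y y', (γ (x₀, y)).1 = (γ (x₀, y')).1) (x : A) :
    ∀ y y', (γ (x, y)).1 = (γ (x, y')).1 := by
  refine (agreeSomewhere_fst_const_or_snd_const hγ (fun p q => (h p q).2) x).elim id fun hx => ?_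
  by_cases hxx : x = x₀
  · rw [hxx]; exact h₀
  -- The images of the two columns now lie on a vertical and a horizontal line. For each y,
  -- agreement puts one of the two image points at their crossing; by injectivity each column can do
  -- so for one y only, so three values of y are too many.
  exfalso
  have hinj : ∀ x y y', (γ (x, y)).1 = (γ (x, y')).1 → (γ (x, y)).2 = (γ (x, y')).2 → y = y' :=
    fun x y y' h1 h2 => (Prod.ext_iff.1 (hγ (Prod.ext h1 h2))).2
  have hag : ∀ y, (γ (x, y)).1 = (γ (x₀, y)).1 ∨ (γ (x, y)).2 = (γ (x₀, y)).2 :=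
    fun y => (h (x, y) (x₀, y)).2 (Or.inr rfl)
  have hA : ∀ y y', y ≠ y' → (γ (x, y)).1 = (γ (x₀, y)).1 → (γ (x, y')).1 ≠ (γ (x₀, y')).1 :=
    fun y y' hy e e' => hy (hinj x y y' (by rw [e, e', h₀ y y']) (hx y y'))
  have hB : ∀ y y', y ≠ y' → (γ (x, y)).2 = (γ (x₀, y)).2 → (γ (x, y')).2 ≠ (γ (x₀, y')).2 :=
    fun y y' hy e e' => hy (hinj x₀ y y' (h₀ y y') (by rw [← e, ← e', hx y y']))
  have := hag y₁
  have := hag y₂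
  have := hag y₃
  have := hA y₁ y₂ h₁₂
  have := hA y₁ y₃ h₁₃
  have := hA y₂ y₃ h₂₃
  have := hB y₁ y₂ h₁₂
  have := hB y₁ y₃ h₁₃
  have := hB y₂ y₃ h₂₃
  tauto

theorem exists_prodMap_of_fst_const (hγ : Function.Injective γ)
    (h : ∀ p q, AgreeSomewhere (γ p) (γ q) ↔ AgreeSomewhere p q)
    {y₁ y₂ y₃ : A} (h₁₂ : y₁ ≠ y₂) (h₁₃ : y₁ ≠ y₃) (h₂₃ : y₂ ≠ y₃) {x₀ : A}
    (h₀ : ∀ y y', (γ (x₀, y)).1 = (γ (x₀, y')).1) :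
    ∃ F G : A → A, ∀ x y, γ (x, y) = (F x, G y) := by
  have h1 := fst_const_of_fst_const hγ h h₁₂ h₁₃ h₂₃ h₀
  refine ⟨fun x => (γ (x, y₁)).1, fun y => (γ (x₀, y)).2, fun x y => Prod.ext (h1 x y y₁) ?_⟩
  by_cases hx : x = x₀
  · rw [hx]
  refine ((h (x, y) (x₀, y)).2 (Or.inr rfl)).resolve_left fun e => ?_
  obtain ⟨y', hy'⟩ : ∃ y', y ≠ y' := by
    by_cases hy : y = y₁
    · exact ⟨y₂, hy ▸ h₁₂⟩
    · exact ⟨y₁, hy⟩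
  -- Equal first coordinates would make the image of (x, y) agree with that of the whole column over
  -- x₀.
  have : AgreeSomewhere (x, y) (x₀, y') := (h _ _).1 (Or.inl (e.trans (h₀ y y')))
  exact this.elim hx hy'

/-- An injection of a square that preserves and reflects agreement in some coordinate is a
product map, up to exchanging the coordinates. -/
theorem exists_prodMap_or_swap (hγ : Function.Injective γ)
    (h : ∀ p q, AgreeSomewhere (γ p) (γ q) ↔ AgreeSomewhere p q)
    {y₁ y₂ y₃ : A} (h₁₂ : y₁ ≠ y₂) (h₁₃ : y₁ ≠ y₃) (h₂₃ : y₂ ≠ y₃) :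
    ∃ F G : A → A, (∀ x y, γ (x, y) = (F x, G y)) ∨ (∀ x y, γ (x, y) = (G y, F x)) := by
  rcases agreeSomewhere_fst_const_or_snd_const hγ (fun p q => (h p q).2) y₁ with h₀ | h₀
  · obtain ⟨F, G, hFG⟩ := exists_prodMap_of_fst_const hγ h h₁₂ h₁₃ h₂₃ h₀
    exact ⟨F, G, Or.inl hFG⟩
  · obtain ⟨F, G, hFG⟩ := exists_prodMap_of_fst_const (γ := Prod.swap ∘ γ)
      (Prod.swap_injective.comp hγ) (fun p q => Or.comm.trans (h p q)) h₁₂ h₁₃ h₂₃ h₀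
    exact ⟨F, G, Or.inr fun x y => Prod.swap_injective (hFG x y)⟩

end Rook

/-! ### Alignment in the bidisk and the form of its isometries. -/

namespace Bidisk

open UpperHalfPlane

theorem dist_sq_eq (z w : Bidisk) :
    dist z w ^ 2 = dist z.fst w.fst ^ 2 + dist z.snd w.snd ^ 2 := by
  rw [dist_eq, Real.sq_sqrt (by positivity)]

/-- Both coordinates of the three points lie on hyperbolic lines. -/
def Aligned (r p q : Bidisk) : Prop :=
  lineDet r.fst p.fst q.fst = 0 ∧ lineDet r.snd p.snd q.snd = 0

/-- The right side mentions distances only, hence is invariant under isometries. -/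
theorem aligned_iff_dist (r p q : Bidisk) : Aligned r p q ↔
    ∀ m : Bidisk, dist p m = dist p q / 2 → dist q m = dist p q / 2 →
      (dist r p ^ 2 + dist r q ^ 2) / 2 - dist p q ^ 2 / 4 - dist r m ^ 2 = 0 := by
  obtain ⟨m₁, hp₁, hq₁, h₁⟩ := exists_midpoint p.fst q.fst
  obtain ⟨m₂, hp₂, hq₂, h₂⟩ := exists_midpoint p.snd q.snd
  set m₀ : Bidisk := WithLp.toLp 2 (m₁, m₂)
  have hfst : m₀.fst = m₁ := rfl
  have hsnd : m₀.snd = m₂ := rfl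
  have hmid : ∀ u : Bidisk, dist u.fst m₁ = dist p.fst q.fst / 2 →
      dist u.snd m₂ = dist p.snd q.snd / 2 → dist u m₀ = dist p q / 2 := by
    intro u hu₁ hu₂
    refine (pow_left_inj₀ dist_nonneg (by positivity) two_ne_zero).1 ?_
    rw [div_pow, dist_sq_eq, dist_sq_eq, hfst, hsnd, hu₁, hu₂]
    ring
  have hD : ∀ r : Bidisk, (dist r p ^ 2 + dist r q ^ 2) / 2 - dist p q ^ 2 / 4 - dist r m₀ ^ 2 =
      medianDefect r.fst p.fst q.fst m₁ + medianDefect r.snd p.snd q.snd m₂ := by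
    intro r
    simp only [dist_sq_eq, medianDefect, hfst, hsnd]
    ring
  -- Applied at another midpoint m, `hD` writes -dist(m, m₀)² as a sum of nonnegative defects.
  have huniq : ∀ m : Bidisk, dist p m = dist p q / 2 → dist q m = dist p q / 2 → m = m₀ := by
    intro m hp hq
    have h := hD m
    rw [dist_comm m p, dist_comm m q, hp, hq] at h
    have e₁ := (h₁ m.fst).1
    have e₂ := (h₂ m.snd).1
    have : dist m m₀ ^ 2 = 0 := le_antisymm (by linarith) (sq_nonneg _)
    exact dist_eq_zero.1 (pow_eq_zero_iff two_ne_zero |>.1 this)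
  have hr : Aligned r p q ↔
      (dist r p ^ 2 + dist r q ^ 2) / 2 - dist p q ^ 2 / 4 - dist r m₀ ^ 2 = 0 := by
    rw [hD, add_eq_zero_iff_of_nonneg (h₁ r.fst).1 (h₂ r.snd).1, (h₁ r.fst).2, (h₂ r.snd).2,
      Aligned]
  rw [hr]
  refine ⟨fun h m hp hq => huniq m hp hq ▸ h, fun h => h m₀ (hmid p hp₁ hp₂) (hmid q hq₁ hq₂)⟩

theorem aligned_map_iff (γ : Isom Bidisk) (r p q : Bidisk) :
    Aligned (γ r) (γ p) (γ q) ↔ Aligned r p q := by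
  rw [aligned_iff_dist, aligned_iff_dist, γ.surjective.forall]
  simp only [γ.dist_eq]

/-- Two points of the bidisk agree in a coordinate if and only if the points aligned with them
are not all aligned with each other. -/
theorem fst_eq_or_snd_eq_iff (p q : Bidisk) : p.fst = q.fst ∨ p.snd = q.snd ↔
    ∃ r s t, Aligned r p q ∧ Aligned s p q ∧ Aligned t p q ∧ ¬ Aligned r s t := by
  constructor
  · obtain ⟨a, b, c, habc⟩ := exists_lineDet_ne_zero
    rintro (h | h)
    · have hal : ∀ x : ℍ, Aligned (WithLp.toLp 2 (x, p.snd)) p q := fun x =>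
        ⟨h ▸ lineDet_self_right _ _, lineDet_self_left _ _⟩
      exact ⟨_, _, _, hal a, hal b, hal c, fun h' => habc h'.1⟩
    · have hal : ∀ x : ℍ, Aligned (WithLp.toLp 2 (p.fst, x)) p q := fun x =>
        ⟨lineDet_self_left _ _, h ▸ lineDet_self_right _ _⟩
      exact ⟨_, _, _, hal a, hal b, hal c, fun h' => habc h'.2⟩
  · rintro ⟨r, s, t, hr, hs, ht, h⟩
    by_contra! hne
    exact h ⟨lineDet_trans hne.1 hr.1 hs.1 ht.1, lineDet_trans hne.2 hr.2 hs.2 ht.2⟩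

theorem map_fst_eq_or_snd_eq_iff (γ : Isom Bidisk) (p q : Bidisk) :
    (γ p).fst = (γ q).fst ∨ (γ p).snd = (γ q).snd ↔ p.fst = q.fst ∨ p.snd = q.snd := by
  rw [fst_eq_or_snd_eq_iff, fst_eq_or_snd_eq_iff, γ.surjective.exists₃]
  simp only [aligned_map_iff]

theorem dist_toLp_left (x x' y : ℍ) :
    dist (WithLp.toLp 2 (x, y) : Bidisk) (WithLp.toLp 2 (x', y)) = dist x x' := by
  rw [dist_eq]; simp

theorem dist_toLp_right (x y y' : ℍ) :
    dist (WithLp.toLp 2 (x, y) : Bidisk) (WithLp.toLp 2 (x, y')) = dist y y' := by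
  rw [dist_eq]; simp

theorem exists_prodHom_of_prodMap (γ : Isom Bidisk) {F G : ℍ → ℍ}
    (h : ∀ x y, γ (WithLp.toLp 2 (x, y)) = WithLp.toLp 2 (F x, G y)) :
    ∃ g : Isom ℍ × Isom ℍ, γ = prodHom g := by
  have hF : Isometry F := Isometry.of_dist_eq fun x x' => by
    have := γ.dist_eq (WithLp.toLp 2 (x, UpperHalfPlane.I)) (WithLp.toLp 2 (x', UpperHalfPlane.I))
    rwa [h, h, dist_toLp_left, dist_toLp_left] at this
  have hG : Isometry G := Isometry.of_dist_eq fun y y' => by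
    have := γ.dist_eq (WithLp.toLp 2 (UpperHalfPlane.I, y)) (WithLp.toLp 2 (UpperHalfPlane.I, y'))
    rwa [h, h, dist_toLp_right, dist_toLp_right] at this
  have hs : ∀ a b : ℍ, ∃ x y, F x = a ∧ G y = b := by
    intro a b
    obtain ⟨z, hz⟩ := γ.surjective (WithLp.toLp 2 (a, b))
    have e : (WithLp.toLp 2 (F z.fst, G z.snd) : Bidisk) = WithLp.toLp 2 (a, b) :=
      (h z.fst z.snd).symm.trans hz
    exact ⟨z.fst, z.snd, congrArg WithLp.fst e, congrArg WithLp.snd e⟩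
  have hFs : Function.Surjective F := fun a => by
    obtain ⟨x, -, hx, -⟩ := hs a a
    exact ⟨x, hx⟩
  have hGs : Function.Surjective G := fun a => by
    obtain ⟨-, y, -, hy⟩ := hs a a
    exact ⟨y, hy⟩
  exact ⟨(⟨Equiv.ofBijective F ⟨hF.injective, hFs⟩, hF⟩,
    ⟨Equiv.ofBijective G ⟨hG.injective, hGs⟩, hG⟩), IsometryEquiv.ext fun z => h z.fst z.snd⟩

theorem swap_mul_swap : swap * swap = 1 := rfl

theorem swap_mul_prodHom_mul_swap (g : Isom ℍ × Isom ℍ) :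
    swap * prodHom g * swap = prodHom g.swap := rfl

theorem exists_eq_prodHom_or (γ : Isom Bidisk) :
    ∃ g : Isom ℍ × Isom ℍ, γ = prodHom g ∨ γ = swap * prodHom g := by
  obtain ⟨a, b, c, habc⟩ := exists_lineDet_ne_zero
  have hab : a ≠ b := fun h => habc (h ▸ lineDet_self_left _ _)
  have hbc : b ≠ c := fun h => habc (h ▸ lineDet_self_right _ _)
  have hac : a ≠ c := fun h => habc (by rw [h, lineDet]; ring)
  obtain ⟨F, G, h | h⟩ := exists_prodMap_or_swap
    (γ := fun z : ℍ × ℍ => WithLp.ofLp (γ (WithLp.toLp 2 z)))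
    (fun z w hzw => WithLp.toLp_injective 2 (γ.injective (WithLp.ofLp_injective 2 hzw)))
    (fun p q => map_fst_eq_or_snd_eq_iff γ (WithLp.toLp 2 p) (WithLp.toLp 2 q)) hab hac hbc
  · obtain ⟨g, hg⟩ := exists_prodHom_of_prodMap γ
      (fun x y => WithLp.ofLp_injective 2 (h x y))
    exact ⟨g, Or.inl hg⟩
  · obtain ⟨g, hg⟩ := exists_prodHom_of_prodMap (swap * γ) (F := F) (G := G)
      (fun x y => congrArg swap (WithLp.ofLp_injective 2 (h x y) :
        γ (WithLp.toLp 2 (x, y)) = WithLp.toLp 2 (G y, F x)))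
    exact ⟨g, Or.inr (by rw [← hg, ← mul_assoc, swap_mul_swap, one_mul])⟩

/-! ### The semidirect product structure. -/

theorem prodHom_injective : Function.Injective prodHom := by
  intro g g' h
  have h' : ∀ z : Bidisk, prodHom g z = prodHom g' z := fun z => by rw [h]
  refine Prod.ext (IsometryEquiv.ext fun x => ?_) (IsometryEquiv.ext fun x => ?_)
  · exact congrArg WithLp.fst (h' (WithLp.toLp 2 (x, x)))
  · exact congrArg WithLp.snd (h' (WithLp.toLp 2 (x, x)))

theorem swap_notMem_Gam : swap ∉ Gam := by
  rintro ⟨g, hg⟩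
  obtain ⟨a, b, c, habc⟩ := exists_lineDet_ne_zero
  have hbc : b ≠ c := fun h => habc (h ▸ UpperHalfPlane.lineDet_self_right _ _)
  have h : ∀ x y : ℍ, g.1 x = y := fun x y =>
    congrArg (fun γ : Isom Bidisk => (γ (WithLp.toLp 2 (x, y))).fst) hg
  exact hbc ((h a b).symm.trans (h a c))

theorem orderOf_swap : orderOf swap = 2 :=
  orderOf_eq_prime (by rw [pow_two, swap_mul_swap]) fun h => swap_notMem_Gam (h ▸ one_mem _)

theorem mem_zpowers_swap_iff (γ : Isom Bidisk) :
    γ ∈ Subgroup.zpowers swap ↔ γ = 1 ∨ γ = swap := by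
  constructor
  · rintro ⟨n, rfl⟩
    rcases Int.even_or_odd' n with ⟨k, rfl | rfl⟩ <;>
      simp [zpow_add, zpow_mul, zpow_ofNat, pow_two, swap_mul_swap]
  · rintro (rfl | rfl)
    · exact one_mem _
    · exact Subgroup.mem_zpowers _

theorem Gam_inf_zpowers_swap : Gam ⊓ Subgroup.zpowers swap = ⊥ := by
  rw [eq_bot_iff]
  rintro γ ⟨h, hz⟩
  rcases (mem_zpowers_swap_iff γ).1 hz with rfl | rfl
  · exact one_mem _
  · exact (swap_notMem_Gam h).elim

theorem Gam_sup_zpowers_swap : Gam ⊔ Subgroup.zpowers swap = ⊤ := by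
  rw [eq_top_iff]
  rintro γ -
  have hG : ∀ g, prodHom g ∈ Gam ⊔ Subgroup.zpowers swap :=
    fun g => Subgroup.mem_sup_left ⟨g, rfl⟩
  obtain ⟨g, rfl | rfl⟩ := exists_eq_prodHom_or γ
  · exact hG g
  · exact mul_mem (Subgroup.mem_sup_right (Subgroup.mem_zpowers _)) (hG g)

instance normal_Gam : Gam.Normal where
  conj_mem := by
    rintro _ ⟨g, rfl⟩ γ
    obtain ⟨k, rfl | rfl⟩ := exists_eq_prodHom_or γ
    · exact ⟨k * g * k⁻¹, by simp⟩
    · refine ⟨(k * g * k⁻¹).swap, ?_⟩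
      rw [← swap_mul_prodHom_mul_swap, mul_inv_rev, inv_eq_of_mul_eq_one_left swap_mul_swap]
      simp [mul_assoc]

/-- The conjugation action of `⟨ι⟩` on `Isom(H²) × Isom(H²)`. -/
def conjAction : Subgroup.zpowers swap →* MulAut (Isom ℍ × Isom ℍ) :=
  (MulAut.congr (MonoidHom.ofInjective prodHom_injective).symm).toMonoidHom.comp
    ((MulAut.conjNormal (H := Gam)).comp (Subgroup.zpowers swap).subtype)

theorem prodHom_conjAction (s : Subgroup.zpowers swap) (g : Isom ℍ × Isom ℍ) :
    prodHom (conjAction s g) = s * prodHom g * (s : Isom Bidisk)⁻¹ := by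
  have h := congrArg Subtype.val ((MonoidHom.ofInjective prodHom_injective).apply_symm_apply
    (MulAut.conjNormal (H := Gam) (s : Isom Bidisk) (MonoidHom.ofInjective prodHom_injective g)))
  exact h.trans (MulAut.conjNormal_apply _ _)

theorem conjAction_swap (g₁ g₂ : Isom ℍ) :
    conjAction ⟨swap, Subgroup.mem_zpowers swap⟩ (g₁, g₂) = (g₂, g₁) := by
  apply prodHom_injective
  rw [prodHom_conjAction]
  rfl

/-- The homomorphism from the external semidirect product to the isometry group. -/
def semidirectHom : (Isom ℍ × Isom ℍ) ⋊[conjAction] Subgroup.zpowers swap →* Isom Bidisk :=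
  SemidirectProduct.lift prodHom (Subgroup.zpowers swap).subtype fun s =>
    MonoidHom.ext fun g => prodHom_conjAction s g

theorem semidirectHom_inl (g : Isom ℍ × Isom ℍ) :
    semidirectHom (SemidirectProduct.inl g) = prodHom g :=
  SemidirectProduct.lift_inl _ _ _ g

theorem semidirectHom_inr (s : Subgroup.zpowers swap) :
    semidirectHom (SemidirectProduct.inr s) = s :=
  SemidirectProduct.lift_inr _ _ _ s

theorem semidirectHom_bijective : Function.Bijective semidirectHom := by
  constructor
  · rw [injective_iff_map_eq_one]
    intro a ha
    have h : prodHom a.left * (a.right : Isom Bidisk) = 1 := ha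
    have hr : (a.right : Isom Bidisk) = 1 := by
      have hmem : (a.right : Isom Bidisk) ∈ Gam ⊓ Subgroup.zpowers swap :=
        ⟨eq_inv_of_mul_eq_one_right h ▸ Gam.inv_mem ⟨_, rfl⟩, a.right.2⟩
      rwa [Gam_inf_zpowers_swap, Subgroup.mem_bot] at hmem
    rw [hr, mul_one] at h
    exact SemidirectProduct.ext (prodHom_injective (h.trans (map_one _).symm)) (Subtype.ext hr)
  · rw [← MonoidHom.range_eq_top, eq_top_iff, ← Gam_sup_zpowers_swap, sup_le_iff]
    constructor
    · rintro _ ⟨g, rfl⟩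
      exact ⟨SemidirectProduct.inl g, semidirectHom_inl g⟩
    · intro s hs
      exact ⟨SemidirectProduct.inr ⟨s, hs⟩, semidirectHom_inr ⟨s, hs⟩⟩

end Bidisk

end

/-- The isometry group of the bidisk is `(Isom(H²) × Isom(H²)) ⋊ ⟨ι⟩`, where `ι` is the swap. -/
theorem mainTheorem2 :
    -- every isometry is a product, or a product composed with the swap
    (∀ γ : Isom Bidisk, ∃ g₁ g₂ : Isom ℍ,
      (∀ z₁ z₂ : ℍ, γ (WithLp.toLp 2 (z₁, z₂)) = WithLp.toLp 2 (g₁ z₁, g₂ z₂)) ∨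
      (∀ z₁ z₂ : ℍ, γ (WithLp.toLp 2 (z₁, z₂)) = WithLp.toLp 2 (g₂ z₂, g₁ z₁))) ∧
    -- `Isom(H²) × Isom(H²)` acts faithfully, so that it is identified with `Γ`
    Function.Injective Bidisk.prodHom ∧
    -- the swap has order two
    orderOf Bidisk.swap = 2 ∧
    -- `Isom(H² × H²)` is the internal semidirect product of `Γ` and `⟨ι⟩`
    Bidisk.Gam.Normal ∧
    Bidisk.Gam ⊓ Subgroup.zpowers Bidisk.swap = ⊥ ∧
    Bidisk.Gam ⊔ Subgroup.zpowers Bidisk.swap = ⊤ ∧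
    -- and the external one, in which `ι` acts by exchanging the two factors
    (∃ φ : Subgroup.zpowers Bidisk.swap →* MulAut (Isom ℍ × Isom ℍ),
      (∀ g₁ g₂ : Isom ℍ,
        φ ⟨Bidisk.swap, Subgroup.mem_zpowers Bidisk.swap⟩ (g₁, g₂) = (g₂, g₁)) ∧
      ∃ e : ((Isom ℍ × Isom ℍ) ⋊[φ] Subgroup.zpowers Bidisk.swap) ≃* Isom Bidisk,
        (∀ g : Isom ℍ × Isom ℍ, e (SemidirectProduct.inl g) = Bidisk.prodHom g) ∧
        (∀ s : Subgroup.zpowers Bidisk.swap,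
          e (SemidirectProduct.inr s) = (s : Isom Bidisk))) := by
  refine ⟨fun γ => ?_, Bidisk.prodHom_injective, Bidisk.orderOf_swap, Bidisk.normal_Gam,
    Bidisk.Gam_inf_zpowers_swap, Bidisk.Gam_sup_zpowers_swap, Bidisk.conjAction,
    Bidisk.conjAction_swap, MulEquiv.ofBijective _ Bidisk.semidirectHom_bijective,
    Bidisk.semidirectHom_inl, Bidisk.semidirectHom_inr⟩
  obtain ⟨g, rfl | rfl⟩ := Bidisk.exists_eq_prodHom_or γ
  · exact ⟨g.1, g.2, Or.inl fun _ _ => rfl⟩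
  · exact ⟨g.1, g.2, Or.inr fun _ _ => rfl⟩
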